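/- Let $n, k \ge 0$ be integers. For $\rho \in S_n$ let $\mathrm{noninv}_m(\rho)$ be the number of increasing subsequences of length $m$ in the word $\rho(1)\rho(2)\cdots\rho(n)$. Let $\nu_k$ be the linear operator on the group algebra $\mathbb{C}S_n$ given on the basis $S_n$ by $$\nu_k(\sigma) = \sum_{\tau \in S_n} \mathrm{noninv}_{n-k}(\sigma^{-1}\tau)\,\tau \quad (k \le n), \qquad \nu_k = 0 \quad (k > n).$$ Then every (complex) eigenvalue of $\nu_k$ is a non-negative integer. -/

import Mathlib

/-- The number of increasing subsequences of length `m` in the word `σ 0, σ 1, …, σ (n - 1)` of a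
permutation `σ`; a subsequence is given by its set `s` of `m` positions. -/
def noninv {n : ℕ} (m : ℕ) (σ : Equiv.Perm (Fin n)) : ℕ :=
  ((Finset.univ : Finset (Fin n)).powersetCard m |>.filter
    fun s => ∀ i ∈ s, ∀ j ∈ s, i < j → σ i < σ j).card

/-- The coefficient of `τ` in `ν_k(σ)`: the number `noninv_{n-k}(σ⁻¹ τ)`. If `k > n` there is no way
of removing `k` of the `n` objects, and the coefficient is `0`. -/
def nuCoeff {n : ℕ} (k : ℕ) (σ τ : Equiv.Perm (Fin n)) : ℕ :=
  if k ≤ n then noninv (n - k) (σ⁻¹ * τ) else 0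

/-- The symmetrized shuffling operator `ν_k` on the group algebra `ℂ S_n`: the linear map that sends
each basis element `σ` to `∑ τ, noninv_{n-k}(σ⁻¹ τ) τ`. -/
noncomputable def nu (n k : ℕ) : Module.End ℂ (MonoidAlgebra ℂ (Equiv.Perm (Fin n))) :=
  (MonoidAlgebra.basis (Equiv.Perm (Fin n)) ℂ).constr ℂ fun σ =>
    ∑ τ : Equiv.Perm (Fin n), MonoidAlgebra.single τ (nuCoeff k σ τ : ℂ)

/-! Write B_n, J_n, R_{n,k} for `bottomToRandom`, `jucysMurphy`, `randomToRandom`, so that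
R_{n+1,k+1} = B_n* R_{n,k} B_n. For k ≤ n, in the right regular representation, R_{n,k} acts on
coefficient functions as k! ν_k (`randomToRandom_eq_sum_noninv`, `coeff_nu_apply`).

The engine is `bottomToRandom_mul_randomToRandom`: B_n R_{n+1,k+1} = (R_{n,k+1} + (k+1)(n+1-k+J_n)
R_{n,k}) B_n. By its adjoint, B_n* carries joint eigenvectors of all R_{n,k} and of the J_i with i ≥
n to joint eigenvectors one level up. Eigenvalues of R_{n,k} stay in k! ℤ, since those of J_n are
integers. The orthogonal complement of the range of B_n* is ker B_n, where R_{n+1,k+1} vanishes. By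
induction such joint eigenvectors span, so every eigenvalue of R_{n,k} lies in k! ℤ. It is
non-negative because R_{n,k} is a positive operator. -/

/-! ### Coxeter generators of type `A` in a star ring -/

/-- Self-adjoint elements `s 0, …, s (N - 1)` that satisfy the Coxeter relations of the symmetric
group on `N + 1` letters. -/
structure IsCoxeterFamily {A : Type*} [Ring A] [StarRing A] (N : ℕ) (s : ℕ → A) : Prop where
  sq : ∀ i < N, s i * s i = 1
  far : ∀ i j, i + 1 < j → j < N → Commute (s j) (s i)
  braid : ∀ i, i + 1 < N → s (i + 1) * s i * s (i + 1) = s i * s (i + 1) * s i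
  star_eq : ∀ i, star (s i) = s i

section Coxeter

variable {A : Type*} [Ring A]

/-- The sum of the cycles `s (m - 1) ⋯ s i` for `i ≤ m` (the bottom-to-random shuffle). -/
def bottomToRandom (s : ℕ → A) : ℕ → A
  | 0 => 1
  | m + 1 => 1 + s m * bottomToRandom s m

/-- The Jucys–Murphy elements. -/
def jucysMurphy (s : ℕ → A) : ℕ → A
  | 0 => 0
  | m + 1 => s m * jucysMurphy s m * s m + s m

/-- The `k!`-fold multiple of the `k`-random-to-random shuffle on the first `n` letters. -/
def randomToRandom [StarRing A] (s : ℕ → A) : ℕ → ℕ → A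
  | _, 0 => 1
  | 0, _ + 1 => 0
  | n + 1, k + 1 => star (bottomToRandom s n) * randomToRandom s n k * bottomToRandom s n

variable [StarRing A] {N : ℕ} {s : ℕ → A}

@[simp]
theorem randomToRandom_zero_right (n : ℕ) : randomToRandom s n 0 = 1 := by
  cases n <;> rfl

namespace IsCoxeterFamily

variable (h : IsCoxeterFamily N s)
include h

/-! ### Commutation relations and adjoints. -/

theorem commute_bottomToRandom {m j : ℕ} (hm : m < j) (hj : j < N) :
    Commute (s j) (bottomToRandom s m) := by
  induction m with
  | zero => exact Commute.one_right _
  | succ m ih =>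
    exact (Commute.one_right _).add_right ((h.far m j hm hj).mul_right (ih (by omega)))

theorem commute_star_bottomToRandom {m j : ℕ} (hm : m < j) (hj : j < N) :
    Commute (s j) (star (bottomToRandom s m)) := by
  have := (h.commute_bottomToRandom hm hj).star_star
  rwa [h.star_eq] at this

theorem commute_jucysMurphy {m j : ℕ} (hm : m < j) (hj : j < N) :
    Commute (s j) (jucysMurphy s m) := by
  induction m with
  | zero => exact Commute.zero_right _
  | succ m ih =>
    have := h.far m j hm hj
    exact ((this.mul_right (ih (by omega))).mul_right this).add_right this

/-- In the symmetric group J_m is the sum of the transpositions (i m) with i < m, which permutations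
of the letters below m only rearrange. Here only the case j + 2 = m needs the braid relation. -/
theorem jucysMurphy_commute {m j : ℕ} (hm : j + 1 < m) (hj : m ≤ N) :
    Commute (jucysMurphy s m) (s j) := by
  induction m with
  | zero => omega
  | succ m ih =>
    rcases Nat.lt_succ_iff_lt_or_eq.1 hm with hlt | rfl
    · have h1 := h.far j m hlt hj
      exact ((h1.mul_left (ih hlt (by omega))).mul_left h1).add_left h1
    · have hb := h.braid j hj
      have hc := (h.commute_jucysMurphy (m := j) (j := j + 1) (by omega) hj).eq
      have h1 := h.sq j (by omega)
      have h2 := h.sq (j + 1) (by omega)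
      simp only [jucysMurphy, Commute, SemiconjBy]
      generalize s (j + 1) = u at *
      generalize jucysMurphy s j = x at *
      generalize s j = t at *
      linear_combination (norm := noncomm_ring) -u * t * x * hb - u * t * hc * t * u + hb * x * t * u
        + hb * t + t * u * h1 + hb * u - u * t * h2

theorem jucysMurphy_commute_bottomToRandom {m i : ℕ} (hi : i < m) (hm : m ≤ N) :
    Commute (jucysMurphy s m) (bottomToRandom s i) := by
  induction i with
  | zero => exact Commute.one_right _
  | succ i ih =>
    exact (Commute.one_right _).add_right ((h.jucysMurphy_commute hi hm).mul_right (ih (by omega)))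

theorem jucysMurphy_commute_jucysMurphy {m i : ℕ} (hi : i < m) (hm : m ≤ N) :
    Commute (jucysMurphy s m) (jucysMurphy s i) := by
  induction i with
  | zero => exact Commute.zero_right _
  | succ i ih =>
    have := h.jucysMurphy_commute hi hm
    exact ((this.mul_right (ih (by omega))).mul_right this).add_right this

theorem star_jucysMurphy (m : ℕ) : star (jucysMurphy s m) = jucysMurphy s m := by
  induction m with
  | zero => simp [jucysMurphy]
  | succ m ih => simp [jucysMurphy, ih, h.star_eq, mul_assoc]

theorem star_bottomToRandom_succ (m : ℕ) :
    star (bottomToRandom s (m + 1)) = 1 + star (bottomToRandom s m) * s m := by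
  simp [bottomToRandom, h.star_eq]

omit h in
theorem star_randomToRandom (n k : ℕ) : star (randomToRandom s n k) = randomToRandom s n k := by
  induction n generalizing k with
  | zero => cases k <;> simp [randomToRandom]
  | succ n ih => cases k <;> simp [randomToRandom, ih, mul_assoc]

theorem commute_randomToRandom {n : ℕ} (hn : n < N) (k : ℕ) :
    Commute (s n) (randomToRandom s n k) := by
  have key : ∀ m ≤ n, ∀ k, Commute (s n) (randomToRandom s m k) := by
    intro m
    induction m with
    | zero => rintro - (_ | k) <;> simp [randomToRandom]
    | succ m ih =>
      rintro hm (_ | k)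
      · simp
      · exact ((h.commute_star_bottomToRandom (by omega) hn).mul_right (ih (by omega) k)).mul_right
          (h.commute_bottomToRandom (by omega) hn)
  exact key n le_rfl k

theorem jucysMurphy_commute_star_bottomToRandom {m i : ℕ} (hi : i < m) (hm : m ≤ N) :
    Commute (jucysMurphy s m) (star (bottomToRandom s i)) := by
  have := (h.jucysMurphy_commute_bottomToRandom hi hm).star_star
  rwa [h.star_jucysMurphy] at this

/-! ### The recursion for random-to-random shuffles. -/

theorem mul_bottomToRandom_mul {m : ℕ} (hm : m < N) :
    s m * (bottomToRandom s m * bottomToRandom s (m + 1)) =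
      bottomToRandom s m * bottomToRandom s (m + 1) := by
  induction m with
  | zero =>
    have := h.sq 0 hm
    simp only [bottomToRandom]
    linear_combination (norm := noncomm_ring) this
  | succ m ih =>
    have ih := ih (by omega)
    have hb := h.braid m hm
    have hc := (h.commute_bottomToRandom (m := m) (j := m + 1) (by omega) hm).eq
    have h2 := h.sq (m + 1) hm
    simp only [bottomToRandom] at ih ⊢
    generalize s (m + 1) = u at *
    generalize s m = t at *
    generalize bottomToRandom s m = x at *
    linear_combination (norm := noncomm_ring) h2 * (1 + t * x) - (u - 1) * t * hc * (1 + t * x)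
      + hb * (x * (1 + t * x)) + t * u * ih

/-- Moves B past its adjoint; this is where J enters the recursion. In the symmetric group, the m +
2 diagonal products of a cycle with its inverse give the constant, and the products of consecutive
cycles, taken in one order, are the transpositions that sum to J. -/
theorem bottomToRandom_mul_star {m : ℕ} (hm : m < N) :
    bottomToRandom s (m + 1) * star (bottomToRandom s (m + 1)) =
      (m + 2 : A) + jucysMurphy s (m + 1) + star (bottomToRandom s m) * s m * bottomToRandom s m := by
  induction m with
  | zero =>
    have := h.sq 0 hm
    simp only [bottomToRandom, jucysMurphy, star_add, star_mul, star_one, h.star_eq, Nat.cast_zero,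
      ← one_add_one_eq_two]
    linear_combination (norm := noncomm_ring) this
  | succ m ih =>
    have ih := ih (by omega)
    have hb := h.braid m hm
    have hc := (h.commute_bottomToRandom (m := m) (j := m + 1) (by omega) hm).eq
    have hc' := (h.commute_star_bottomToRandom (m := m) (j := m + 1) (by omega) hm).eq
    have h2 := h.sq (m + 1) hm
    rw [h.star_bottomToRandom_succ (m + 1)]
    rw [h.star_bottomToRandom_succ m] at ih ⊢
    rw [jucysMurphy, bottomToRandom]
    rw [bottomToRandom] at ih ⊢
    push_cast
    generalize s (m + 1) = u at *
    generalize jucysMurphy s (m + 1) = j at *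
    generalize s m = t at *
    generalize star (bottomToRandom s m) = y at *
    generalize bottomToRandom s m = x at *
    have hcast : ((m : A) + 2) * u = u * (m + 2) := by
      have := (Nat.cast_commute (m + 2) u).eq
      push_cast at this
      exact this
    generalize (m : A) = c at *
    linear_combination (norm := noncomm_ring) u * ih * u + (c + 2) * h2 - hcast * u
      + hc' * t * x * u - y * u * t * hc + y * hb * x

/-- Induction on n: `bottomToRandom_mul_star` moves B_{n+1} past B_{n+1}*, the induction hypothesis
applies after B_n* s_n, and `mul_bottomToRandom_mul` absorbs the leftover s_n. -/
theorem bottomToRandom_mul_randomToRandom {n : ℕ} (hn : n ≤ N) (k : ℕ) :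
    bottomToRandom s n * randomToRandom s (n + 1) (k + 1) =
      (randomToRandom s n (k + 1) +
        (k + 1 : A) * ((n + 1 - k : A) + jucysMurphy s n) * randomToRandom s n k) *
        bottomToRandom s n := by
  induction n generalizing k with
  | zero =>
    cases k <;> simp [randomToRandom, bottomToRandom, jucysMurphy]
  | succ n ih =>
    have hs := h.mul_bottomToRandom_mul (m := n) (by omega)
    have ha := h.bottomToRandom_mul_star (m := n) (by omega)
    have hj := (h.jucysMurphy_commute_star_bottomToRandom (Nat.lt_succ_self n) hn).eq
    rw [randomToRandom]
    rcases k with _ | k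
    · simp only [randomToRandom, randomToRandom_zero_right]
      generalize bottomToRandom s (n + 1) = z at *
      generalize star z = z' at *
      push_cast
      linear_combination (norm := noncomm_ring) ha * z + star (bottomToRandom s n) * hs
    · have ih := ih (by omega) k
      have hq := (h.commute_randomToRandom (n := n) (by omega) (k + 1)).eq
      have hq' := (h.commute_randomToRandom (n := n) (by omega) k).eq
      have hx : jucysMurphy s (n + 1) * s n = s n * jucysMurphy s n + 1 := by
        have := h.sq n (by omega)
        rw [jucysMurphy]
        linear_combination (norm := noncomm_ring) s n * jucysMurphy s n * this + this
      have hQ : randomToRandom s (n + 1) (k + 1) =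
        star (bottomToRandom s n) * randomToRandom s n k * bottomToRandom s n := rfl
      have hQ' : randomToRandom s (n + 1) (k + 1 + 1) =
        star (bottomToRandom s n) * randomToRandom s n (k + 1) * bottomToRandom s n := rfl
      -- The casts become opaque central elements; M is unchanged when n and k both grow by one.
      obtain ⟨K, hK⟩ : ∃ K : A, K = k + 1 := ⟨_, rfl⟩
      obtain ⟨M, hM⟩ : ∃ M : A, M = n + 1 - k := ⟨_, rfl⟩
      have hKc : ∀ x, x * K = K * x := fun x => by
        have := (Nat.cast_commute (k + 1) x).eq
        push_cast at this
        rw [hK, this]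
      have hMc : ∀ x, x * M = M * x := fun x => by
        have h1 := (Nat.cast_commute (n + 1) x).eq
        have h2 := (Nat.cast_commute k x).eq
        push_cast at h1
        rw [hM, mul_sub, sub_mul, h1, h2]
      have e1 : ((k + 1 : ℕ) : A) + 1 = K + 1 := by rw [hK]; push_cast; rfl
      have e2 : ((n + 1 : ℕ) : A) + 1 - ((k + 1 : ℕ) : A) = M := by rw [hM]; push_cast; abel
      have e3 : (n : A) + 2 = M + K := by
        rw [hM, hK, ← one_add_one_eq_two]; abel
      rw [e1, e2, hQ']
      rw [← hK, ← hM] at ih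
      rw [e3] at ha
      clear e1 e2 e3 hK hM hQ'
      have h1 := hKc (s n)
      have h2 := hMc (s n)
      have h3 := hKc (star (bottomToRandom s n))
      have h4 := hMc (star (bottomToRandom s n))
      clear hKc hMc
      generalize bottomToRandom s (n + 1) = z at *
      generalize star z = z' at *
      generalize randomToRandom s (n + 1) (k + 1) = q at *
      generalize randomToRandom s n (k + 1) = a at *
      generalize randomToRandom s n k = d at *
      generalize jucysMurphy s (n + 1) = J at *
      generalize jucysMurphy s n = j at *
      generalize star (bottomToRandom s n) = y at *
      generalize bottomToRandom s n = b at *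
      generalize s n = t at *
      -- Pushing s_n past J_n turns it into J_{n+1} and costs a -1. This makes the coefficients add
      -- up: (M + K + J) + K(M + J - 1) = (K + 1)(M + J).
      have key : t * ((a + K * (M + j) * d) * (b * z)) = (a + K * (M + J - 1) * d) * (b * z) := by
        linear_combination (norm := noncomm_ring) hq * (b * z) + a * hs + h1 * (M + j) * d * b * z
          + K * h2 * d * b * z + K * M * hq' * b * z + K * M * d * hs - K * hx * d * b * z
          + K * J * hq' * b * z + K * J * d * hs
      linear_combination (norm := noncomm_ring) ha * q * z + y * t * ih * z + y * key
        + h3 * (M + J - 1) * d * b * z + K * h4 * d * b * z - K * hj * d * b * z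
        - (K * M + K * J - K) * hQ * z

end IsCoxeterFamily

end Coxeter


/-! ### Spectrum of the Jucys–Murphy elements and of the random-to-random operators -/

open Module.End

section Spectrum

variable {E : Type*} [NormedAddCommGroup E] [InnerProductSpace ℂ E] [FiniteDimensional ℂ E]

/-- Two commuting operators have a common eigenvector for a given eigenvalue of the second. -/
theorem Module.End.exists_common_eigenvector {V : Type*} [AddCommGroup V] [Module ℂ V]
    [FiniteDimensional ℂ V] {f g : Module.End ℂ V} (hfg : Commute f g) {b : ℂ}
    (hb : g.HasEigenvalue b) : ∃ (a : ℂ) (v : V), v ≠ 0 ∧ f v = a • v ∧ g v = b • v := by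
  have hmaps : ∀ x ∈ eigenspace g b, f x ∈ eigenspace g b := fun x hx => by
    rw [mem_eigenspace_iff] at hx ⊢
    have := LinearMap.congr_fun hfg.eq x
    simp only [Module.End.mul_apply] at this
    rw [← this, hx, map_smul]
  have : Nontrivial (eigenspace g b) := Submodule.nontrivial_iff_ne_bot.2 hb
  obtain ⟨a, ha⟩ := Module.End.exists_eigenvalue (f.restrict hmaps)
  obtain ⟨v, hv⟩ := ha.exists_hasEigenvector
  refine ⟨a, v, by simpa using hv.2, ?_, mem_eigenspace_iff.1 v.2⟩
  simpa using congrArg Subtype.val hv.apply_eq_smul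

namespace IsCoxeterFamily

variable {N : ℕ} {s : ℕ → Module.End ℂ E} (h : IsCoxeterFamily N s)
include h

/-- The Okounkov–Vershik argument. Let v be a common eigenvector of J_m and J_{m+1}, with values c
and b. Then w = (b - c) s_m v - v satisfies J_m w = b w. If w ≠ 0, induction applies to b; if w = 0,
then s_m² = 1 forces b - c = ±1. -/
theorem eigenvalue_jucysMurphy {m : ℕ} (hm : m ≤ N) {b : ℂ}
    (hb : (jucysMurphy s m).HasEigenvalue b) : ∃ c : ℤ, b = c := by
  induction m generalizing b with
  | zero =>
    obtain ⟨v, hv⟩ := hb.exists_hasEigenvector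
    have := hv.apply_eq_smul
    simp only [jucysMurphy, LinearMap.zero_apply] at this
    exact ⟨0, by simpa using (smul_eq_zero.1 this.symm).resolve_right hv.2⟩
  | succ m ih =>
    obtain ⟨a, v, hv0, hav, hbv⟩ := exists_common_eigenvector
      (h.jucysMurphy_commute_jucysMurphy (Nat.lt_succ_self m) hm).symm hb
    obtain ⟨c, rfl⟩ := ih (by omega)
      (hasEigenvalue_of_hasEigenvector ⟨mem_eigenspace_iff.2 hav, hv0⟩)
    have hs : ∀ x, s m (s m x) = x := fun x => by
      have := LinearMap.congr_fun (h.sq m hm) x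
      simpa using this
    have hrel : jucysMurphy s m (s m v) = b • s m v - v := by
      have h1 : jucysMurphy s (m + 1) v = s m (jucysMurphy s m (s m v)) + s m v := by
        simp [jucysMurphy]
      rw [hbv] at h1
      have h2 := congrArg (s m) h1
      rw [map_add, hs, hs, map_smul] at h2
      rw [h2, add_sub_cancel_right]
    by_cases hbc : b = c
    · exact ⟨c, hbc⟩
    · have hbc' : b - c ≠ 0 := sub_ne_zero.2 hbc
      by_cases hw : (b - c) • s m v - v = 0
      · have h1 : (b - c) • s m v = v := sub_eq_zero.1 hw
        have h2 : ((b - c) * (b - c)) • v = v := by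
          have h3 := congrArg (s m) h1
          rw [map_smul, hs] at h3
          rw [mul_smul, h3, h1]
        have h3 : (b - c) * (b - c) = 1 := by
          have : ((b - c) * (b - c) - 1) • v = 0 := by rw [sub_smul, h2, one_smul, sub_self]
          exact sub_eq_zero.1 ((smul_eq_zero.1 this).resolve_right hv0)
        rcases mul_self_eq_one_iff.1 h3 with h4 | h4
        · exact ⟨c + 1, by push_cast; rw [← h4]; ring⟩
        · exact ⟨c - 1, by push_cast; linear_combination h4⟩
      · refine ih (by omega) (hasEigenvalue_of_hasEigenvector ⟨mem_eigenspace_iff.2 ?_, hw⟩)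
        rw [map_sub, map_smul, hrel, hav]
        module

/-- Joint eigenvectors of the random-to-random operators on `n` letters and of the Jucys–Murphy
elements that commute with them. -/
def jointEigenvectors (N : ℕ) (s : ℕ → Module.End ℂ E) (n : ℕ) : Set E :=
  {v | (∀ k, ∃ z : ℤ, randomToRandom s n k v = ((k.factorial : ℂ) * z) • v) ∧
    ∀ i, n ≤ i → i ≤ N → ∃ c : ℤ, jucysMurphy s i v = (c : ℂ) • v}

theorem isSymmetric_jucysMurphy (m : ℕ) : (jucysMurphy s m).IsSymmetric :=
  (LinearMap.isSymmetric_iff_isSelfAdjoint _).2 (h.star_jucysMurphy m)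

/-- Every R_{0,k} is 0 or 1, so only the commuting self-adjoint Jucys–Murphy elements have to be
diagonalized. -/
theorem span_jointEigenvectors_zero : Submodule.span ℂ (jointEigenvectors N s 0) = ⊤ := by
  have hC : Pairwise (Function.onFun Commute fun i : Fin (N + 1) => jucysMurphy s i) := by
    intro i j hij
    rcases lt_or_gt_of_ne hij with hlt | hlt
    · exact (h.jucysMurphy_commute_jucysMurphy hlt (by omega)).symm
    · exact h.jucysMurphy_commute_jucysMurphy hlt (by omega)
  rw [eq_top_iff, ← LinearMap.IsSymmetric.iSup_iInf_eq_top_of_commute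
    (fun i : Fin (N + 1) => h.isSymmetric_jucysMurphy i) hC, iSup_le_iff]
  intro χ v hv
  rw [Submodule.mem_iInf] at hv
  by_cases hv0 : v = 0
  · rw [hv0]; exact zero_mem _
  refine Submodule.subset_span ⟨fun k => ?_, fun i _ hi => ?_⟩
  · cases k with
    | zero => exact ⟨1, by simp⟩
    | succ k => exact ⟨0, by simp [randomToRandom]⟩
  · have hvi := hv ⟨i, by omega⟩
    obtain ⟨c, hc⟩ := h.eigenvalue_jucysMurphy hi
      (hasEigenvalue_of_hasEigenvector ⟨hvi, hv0⟩)
    exact ⟨c, hc ▸ mem_eigenspace_iff.1 hvi⟩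

theorem star_bottomToRandom_mem_jointEigenvectors {n : ℕ} (hn : n ≤ N) {v : E}
    (hv : v ∈ jointEigenvectors N s n) :
    star (bottomToRandom s n) v ∈ jointEigenvectors N s (n + 1) := by
  obtain ⟨hq, hj⟩ := hv
  refine ⟨fun k => ?_, fun i hi hiN => ?_⟩
  · cases k with
    | zero => exact ⟨1, by simp⟩
    | succ k =>
      obtain ⟨z, hz⟩ := hq (k + 1)
      obtain ⟨w, hw⟩ := hq k
      obtain ⟨c, hc⟩ := hj n le_rfl hn
      -- The adjoint recursion read on eigenvalues; its factor k + 1 is absorbed by (k+1)! = (k+1)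
      -- k!.
      refine ⟨z + (n + 1 - k + c) * w, ?_⟩
      have := congrArg star (h.bottomToRandom_mul_randomToRandom hn k)
      have hcast : ∀ m : ℕ, star (m : Module.End ℂ E) = m := fun m => star_natCast m
      simp only [star_mul, star_add, star_sub, star_one, hcast, star_randomToRandom,
        h.star_jucysMurphy] at this
      have := LinearMap.congr_fun this v
      simp only [Module.End.mul_apply, LinearMap.add_apply, LinearMap.sub_apply,
        Module.End.one_apply, Module.End.natCast_apply] at this
      rw [this, hz]
      have e : n • (k • v + v) + (k • v + v) - k • (k • v + v) + jucysMurphy s n (k • v + v) =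
          (((k : ℂ) + 1) * (n + 1 - k + c)) • v := by
        simp only [map_add, map_nsmul, hc]
        module
      rw [e, map_smul, hw, ← smul_assoc, ← add_smul, map_smul, Nat.factorial_succ]
      congr 1
      push_cast
      simp only [smul_eq_mul]
      ring
  · obtain ⟨c, hc⟩ := hj i (by omega) hiN
    refine ⟨c, ?_⟩
    have := LinearMap.congr_fun
      (h.jucysMurphy_commute_star_bottomToRandom (i := n) (m := i) (by omega) hiN).eq v
    simp only [Module.End.mul_apply] at this
    rw [this, hc, map_smul]

/-- The range of B* is covered by the previous level. For the rest, it suffices to split each joint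
eigenvector of level 0 as x + B* y with B x = 0: then x is killed by R_{n+1,k+1} and is still an
eigenvector of the remaining J_i. -/
theorem span_jointEigenvectors {n : ℕ} (hn : n ≤ N + 1) :
    Submodule.span ℂ (jointEigenvectors N s n) = ⊤ := by
  induction n with
  | zero => exact h.span_jointEigenvectors_zero
  | succ n ih =>
    have ih := ih (by omega)
    set B := bottomToRandom s n with hB
    have hrange : LinearMap.range (star B) ≤ Submodule.span ℂ (jointEigenvectors N s (n + 1)) := by
      rw [LinearMap.range_eq_map, ← ih, Submodule.map_span, Submodule.span_le]
      rintro _ ⟨v, hv, rfl⟩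
      exact Submodule.subset_span (h.star_bottomToRandom_mem_jointEigenvectors (by omega) hv)
    have hcompl : ∀ v, ∃ x y, v = x + star B y ∧ B x = 0 := by
      intro v
      obtain ⟨y, hy, x, hx, rfl⟩ :=
        (LinearMap.range (star B)).exists_add_mem_mem_orthogonal v
      obtain ⟨y, rfl⟩ := hy
      refine ⟨x, y, add_comm _ _, ?_⟩
      rw [← inner_self_eq_zero (𝕜 := ℂ), ← LinearMap.adjoint_inner_left, ← LinearMap.star_eq_adjoint]
      exact hx _ (LinearMap.mem_range_self _ _)
    have hdisj : ∀ x, B (star B x) = 0 → star B x = 0 := by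
      intro x hx
      rw [← inner_self_eq_zero (𝕜 := ℂ)]
      nth_rewrite 1 [LinearMap.star_eq_adjoint]
      rw [LinearMap.adjoint_inner_left, hx, inner_zero_right]
    rw [eq_top_iff, ← h.span_jointEigenvectors_zero, Submodule.span_le]
    intro v hv
    obtain ⟨x, y, rfl, hx⟩ := hcompl v
    refine add_mem (Submodule.subset_span ⟨fun k => ?_, fun i hi hiN => ?_⟩)
      (hrange (LinearMap.mem_range_self _ y))
    · cases k with
      | zero => exact ⟨1, by simp⟩
      | succ k => exact ⟨0, by simp [randomToRandom, ← hB, hx]⟩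
    · obtain ⟨c, hc⟩ := hv.2 i (Nat.zero_le _) hiN
      refine ⟨c, ?_⟩
      have h1 := h.jucysMurphy_commute_bottomToRandom (i := n) (m := i) (by omega) hiN
      have h2 := h.jucysMurphy_commute_star_bottomToRandom (i := n) (m := i) (by omega) hiN
      have h1 := fun w => LinearMap.congr_fun h1.eq w
      have h2 := fun w => LinearMap.congr_fun h2.eq w
      simp only [Module.End.mul_apply, ← hB] at h1 h2
      set J := jucysMurphy s i
      -- This vector lies both in the range of B* and in ker B, which meet only in 0.
      have e : J x - (c : ℂ) • x = star B ((c : ℂ) • y - J y) := by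
        rw [map_sub, map_smul, ← h2, sub_eq_sub_iff_add_eq_add, ← map_add, hc, smul_add]
        abel
      have e0 : B (J x - (c : ℂ) • x) = 0 := by
        rw [map_sub, map_smul, ← h1, hx]; simp
      rw [e] at e0
      rw [hdisj _ e0] at e
      exact sub_eq_zero.1 e

-- ⟨v, B* R B v⟩ = ⟨B v, R B v⟩, so positivity passes up the recursion.
omit h in
theorem inner_randomToRandom_nonneg (n k : ℕ) (v : E) :
    0 ≤ (inner ℂ v (randomToRandom s n k v)).re := by
  induction n generalizing k v with
  | zero =>
    cases k with
    | zero => simpa using inner_self_nonneg (𝕜 := ℂ) (x := v)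
    | succ k => simp [randomToRandom]
  | succ n ih =>
    cases k with
    | zero => simpa using inner_self_nonneg (𝕜 := ℂ) (x := v)
    | succ k =>
      simp only [randomToRandom, Module.End.mul_apply, LinearMap.star_eq_adjoint,
        LinearMap.adjoint_inner_right]
      exact ih k _

/-- Eigenspaces are independent, and those with eigenvalue in k! ℤ already span, so any other is
trivial. -/
theorem integer_eigenvalue_randomToRandom {n : ℕ} (hn : n ≤ N + 1) (k : ℕ) {z : ℂ}
    (hz : (randomToRandom s n k).HasEigenvalue (k.factorial * z)) : ∃ m : ℤ, z = m := by
  by_contra! hne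
  set f := randomToRandom s n k
  have hk : (k.factorial : ℂ) ≠ 0 := Nat.cast_ne_zero.2 k.factorial_ne_zero
  have hle : (⊤ : Submodule ℂ E) ≤ ⨆ j, ⨆ (_ : j ≠ k.factorial * z), eigenspace f j := by
    rw [← h.span_jointEigenvectors hn, Submodule.span_le]
    intro v hv
    obtain ⟨m, hm⟩ := hv.1 k
    refine Submodule.mem_iSup_of_mem (k.factorial * m : ℂ) (Submodule.mem_iSup_of_mem ?_
      (mem_eigenspace_iff.2 hm))
    exact fun e => hne m (mul_left_cancel₀ hk e).symm
  have := (eigenspaces_iSupIndep f) (k.factorial * z : ℂ)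
  exact hz (by simpa using this.mono_right hle)

/-- The eigenvalues of the `k`-random-to-random operators are natural numbers. -/
theorem eigenvalue_randomToRandom {n : ℕ} (hn : n ≤ N + 1) (k : ℕ) {z : ℂ}
    (hz : (randomToRandom s n k).HasEigenvalue (k.factorial * z)) : ∃ m : ℕ, z = m := by
  obtain ⟨m, rfl⟩ : ∃ m : ℤ, z = m := h.integer_eigenvalue_randomToRandom hn k hz
  obtain ⟨v, hv⟩ := hz.exists_hasEigenvector
  have h1 := inner_randomToRandom_nonneg (s := s) n k v
  rw [hv.apply_eq_smul, inner_smul_right, inner_self_eq_norm_sq_to_K] at h1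
  have h2 : (0 : ℝ) < ‖v‖ ^ 2 := by have := norm_pos_iff.2 hv.2; positivity
  have h3 : (0 : ℝ) ≤ k.factorial * m * ‖v‖ ^ 2 := by
    convert h1 using 1
    rw [← Complex.ofReal_re (k.factorial * m * ‖v‖ ^ 2)]
    push_cast
    rfl
  have h4 : (0 : ℝ) < k.factorial := by positivity
  have h5 : (0 : ℝ) ≤ m := nonneg_of_mul_nonneg_right (nonneg_of_mul_nonneg_left h3 h2) h4
  obtain ⟨a, rfl⟩ := Int.eq_ofNat_of_zero_le (Int.cast_nonneg_iff.1 h5)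
  exact ⟨a, by simp⟩

end IsCoxeterFamily

end Spectrum


/-! ### The right regular representation of the symmetric group -/

open Equiv

section Regular

variable {n : ℕ}

/-- Right translation by `g` on the functions on a finite group. -/
def rightTranslation {G : Type*} [Group G] [Fintype G] :
    G →* Module.End ℂ (EuclideanSpace ℂ G) where
  toFun g :=
    { toFun := fun f => WithLp.toLp 2 fun x => f (x * g)
      map_add' := fun _ _ => rfl
      map_smul' := fun _ _ => rfl }
  map_one' := by ext f x; simp
  map_mul' g h := by
    ext f x
    exact congrArg f (mul_assoc x g h).symm

@[simp]
theorem rightTranslation_apply {G : Type*} [Group G] [Fintype G] (g : G)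
    (f : EuclideanSpace ℂ G) (x : G) : rightTranslation g f x = f (x * g) := rfl

theorem star_rightTranslation {G : Type*} [Group G] [Fintype G] (g : G) :
    star (rightTranslation g) = rightTranslation g⁻¹ := by
  rw [LinearMap.star_eq_adjoint, eq_comm, LinearMap.eq_adjoint_iff]
  intro x y
  simp only [PiLp.inner_apply, rightTranslation_apply]
  exact Fintype.sum_equiv (Equiv.mulRight g⁻¹) _ _ fun a => by simp

/-- The transposition of the positions `i` and `i + 1`. -/
def adjacentSwap (n i : ℕ) : Perm (Fin n) :=
  if h : i + 1 < n then swap ⟨i, by omega⟩ ⟨i + 1, h⟩ else 1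

theorem adjacentSwap_mul_self (i : ℕ) : adjacentSwap n i * adjacentSwap n i = 1 := by
  unfold adjacentSwap
  split_ifs <;> simp

theorem adjacentSwap_apply_val {i : ℕ} (h : i + 1 < n) (a : Fin n) :
    (adjacentSwap n i a).val = if a.val = i then i + 1 else if a.val = i + 1 then i else a.val := by
  simp only [adjacentSwap, h, dif_pos, swap_apply_def, Fin.ext_iff]
  split_ifs <;> rfl

theorem isCoxeterFamily_adjacentSwap (n : ℕ) :
    IsCoxeterFamily (n - 1) fun i => rightTranslation (adjacentSwap n i) where
  sq i _ := by rw [← map_mul, adjacentSwap_mul_self, map_one]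
  far i j hij hj := by
    refine Commute.map (show _ = _ from ?_) rightTranslation
    ext a
    simp only [Perm.mul_apply, adjacentSwap_apply_val (show i + 1 < n by omega),
      adjacentSwap_apply_val (show j + 1 < n by omega)]
    grind
  braid i hi := by
    simp only [← map_mul]
    congr 1
    ext a
    simp only [Perm.mul_apply, adjacentSwap_apply_val (show i + 1 < n by omega),
      adjacentSwap_apply_val (show i + 1 + 1 < n by omega)]
    grind
  star_eq i := by
    rw [star_rightTranslation, inv_eq_of_mul_eq_one_right (adjacentSwap_mul_self i)]

/-! ### Factorization through permutations increasing on an initial segment. -/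

/-- The permutations whose restriction to the first `m` positions is increasing, except that the
entry at position `t` may be smaller than the entries before it. -/
def increasingExcept (n m t : ℕ) : Finset (Perm (Fin n)) :=
  {ρ | ∀ i j : Fin n, i < j → j.val < m → j.val ≠ t → ρ i < ρ j}

/-- The permutations that are increasing on the first `m` positions. -/
def increasingOn (n m : ℕ) : Finset (Perm (Fin n)) :=
  {ρ | ∀ i j : Fin n, i < j → j.val < m → ρ i < ρ j}

theorem increasingExcept_zero (m : ℕ) : increasingExcept n m 0 = increasingOn n m := by
  ext ρ
  simp only [increasingExcept, increasingOn, Finset.mem_filter_univ]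
  exact forall₄_congr fun i j hij hj => imp_iff_right (by have := Fin.lt_def.1 hij; omega)

theorem increasingExcept_self (m : ℕ) : increasingExcept n (m + 1) m = increasingOn n m := by
  ext ρ
  simp only [increasingExcept, increasingOn, Finset.mem_filter_univ]
  exact ⟨fun h i j hij hj => h i j hij (by omega) (by omega),
    fun h i j hij hj hj' => h i j hij (by omega)⟩

theorem increasingExcept_filter_lt {m t : ℕ} (ht : t + 1 < n) (htm : t + 1 < m) :
    (increasingExcept n m (t + 1)).filter (fun ρ => ρ ⟨t, by omega⟩ < ρ ⟨t + 1, ht⟩) =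
      increasingOn n m := by
  ext ρ
  simp only [increasingExcept, increasingOn, Finset.mem_filter, Finset.mem_univ, true_and]
  constructor
  · rintro ⟨h1, h2⟩ i j hij hj
    by_cases hjt : j.val = t + 1
    · obtain rfl : j = ⟨t + 1, ht⟩ := Fin.ext hjt
      rcases eq_or_ne i ⟨t, by omega⟩ with hi | hi
      · rw [hi]; exact h2
      · refine (h1 i ⟨t, by omega⟩ ?_ (by simp at hj ⊢; omega) (by simp)).trans h2
        rw [Fin.lt_def] at hij ⊢
        rw [Ne, Fin.ext_iff] at hi
        simp at hij hi ⊢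
        omega
    · exact h1 i j hij hj hjt
  · exact fun h => ⟨fun i j hij hj _ => h i j hij hj, h _ _ (by simp [Fin.lt_def]) htm⟩

theorem mul_adjacentSwap_mem_increasingExcept {m t : ℕ} (ht : t + 1 < n) (htm : t + 1 < m)
    (ρ : Perm (Fin n)) : ρ * adjacentSwap n t ∈ increasingExcept n m t ↔
      ρ ∈ increasingExcept n m (t + 1) ∧ ¬ ρ ⟨t, by omega⟩ < ρ ⟨t + 1, ht⟩ := by
  have hs := adjacentSwap_apply_val (n := n) ht
  have hne : ρ ⟨t + 1, ht⟩ ≠ ρ ⟨t, by omega⟩ := fun e => by simpa using ρ.injective e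
  have hss : ∀ x, adjacentSwap n t (adjacentSwap n t x) = x := fun x =>
    DFunLike.congr_fun (adjacentSwap_mul_self (n := n) t) x
  simp only [increasingExcept, Finset.mem_filter_univ, Perm.mul_apply, not_lt]
  constructor
  · intro h
    refine ⟨fun i j hij hj hjt => ?_, ?_⟩
    · have := h (adjacentSwap n t i) (adjacentSwap n t j)
      rw [hss, hss] at this
      refine this ?_ ?_ ?_
      all_goals
        have h1 := hs i
        have h2 := hs j
        simp only [Fin.lt_def] at hij ⊢
        split_ifs at h1 h2 <;> omega
    · have := h ⟨t, by omega⟩ ⟨t + 1, ht⟩ (by simp [Fin.lt_def]) htm (by simp)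
      have e1 : adjacentSwap n t ⟨t, by omega⟩ = ⟨t + 1, ht⟩ := Fin.ext (by rw [hs]; simp)
      have e2 : adjacentSwap n t ⟨t + 1, ht⟩ = ⟨t, by omega⟩ := Fin.ext (by rw [hs]; simp)
      rw [e1, e2] at this
      exact this.le
  · rintro ⟨h1, h2⟩ i j hij hj hjt
    by_cases hcase : i.val = t ∧ j.val = t + 1
    · have e1 : adjacentSwap n t i = ⟨t + 1, ht⟩ := Fin.ext (by rw [hs, if_pos hcase.1])
      have e2 : adjacentSwap n t j = ⟨t, by omega⟩ :=
        Fin.ext (by rw [hs, if_neg (by omega), if_pos hcase.2])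
      rw [e1, e2]
      exact lt_of_le_of_ne h2 hne
    · refine h1 _ _ ?_ ?_ ?_
      all_goals
        have h1 := hs i
        have h2 := hs j
        simp only [Fin.lt_def] at hij ⊢
        split_ifs at h1 h2 <;> omega

/-- In B_{t+1}* = 1 + B_t* s_t, the 1 yields the permutations with an ascent at positions t, t + 1,
and s_t moves the exceptional entry from t to t + 1, yielding those with a descent. -/
theorem sum_increasingOn_mul_star_bottomToRandom {m t : ℕ} (hm : m ≤ n) (ht : t < m) :
    (∑ ρ ∈ increasingOn n m, rightTranslation ρ) *
        star (bottomToRandom (fun i => rightTranslation (adjacentSwap n i)) t) =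
      ∑ ρ ∈ increasingExcept n m t, rightTranslation ρ := by
  induction t with
  | zero => simp [bottomToRandom, increasingExcept_zero]
  | succ t ih =>
    have htn : t + 1 < n := by omega
    rw [(isCoxeterFamily_adjacentSwap n).star_bottomToRandom_succ, mul_add, mul_one, ← mul_assoc,
      ih (by omega), ← Finset.sum_filter_add_sum_filter_not (increasingExcept n m (t + 1))
        (fun ρ => ρ ⟨t, by omega⟩ < ρ ⟨t + 1, htn⟩), increasingExcept_filter_lt htn ht, Finset.sum_mul]
    congr 1
    refine Finset.sum_nbij' (· * adjacentSwap n t) (· * adjacentSwap n t) ?_ ?_ ?_ ?_ ?_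
    · intro ρ hρ
      rw [Finset.mem_filter, ← mul_adjacentSwap_mem_increasingExcept htn ht, mul_assoc,
        adjacentSwap_mul_self, mul_one]
      exact hρ
    · intro ρ hρ
      rw [Finset.mem_filter, ← mul_adjacentSwap_mem_increasingExcept htn ht] at hρ
      exact hρ
    · intro ρ _; simp [mul_assoc, adjacentSwap_mul_self]
    · intro ρ _; simp [mul_assoc, adjacentSwap_mul_self]
    · intro ρ _; rw [map_mul]

theorem increasingOn_self : increasingOn n n = {1} := by
  ext ρ
  simp only [increasingOn, Finset.mem_filter_univ, Finset.mem_singleton]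
  constructor
  · intro h
    have hm : StrictMono ρ := fun i j hij => h i j hij j.2
    have := Subsingleton.elim (hm.orderIsoOfSurjective ρ ρ.surjective) (OrderIso.refl (Fin n))
    exact Equiv.ext fun x => DFunLike.congr_fun this x
  · rintro rfl i j hij _
    exact hij

/-- With X_m the sum over `increasingOn n m`, X_n = 1 and X_{m+1} B_m* = X_m, so each unfolded layer
of R is absorbed into the outer factors. -/
theorem randomToRandom_eq_mul_star {m j : ℕ} (hmj : m + j = n) (k : ℕ) :
    randomToRandom (fun i => rightTranslation (adjacentSwap n i)) n (k + j) =
      (∑ ρ ∈ increasingOn n m, rightTranslation ρ) *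
        randomToRandom (fun i => rightTranslation (adjacentSwap n i)) m k *
        star (∑ ρ ∈ increasingOn n m, rightTranslation ρ) := by
  induction j generalizing m k with
  | zero =>
    obtain rfl : m = n := by omega
    simp [increasingOn_self]
  | succ j ih =>
    rw [show k + (j + 1) = k + 1 + j by ring, ih (m := m + 1) (by omega), randomToRandom,
      ← increasingExcept_self m,
      ← sum_increasingOn_mul_star_bottomToRandom (by omega) (Nat.lt_succ_self m)]
    simp only [star_mul, star_star, mul_assoc]

/-! ### Coefficients as counts of increasing subsequences. -/

theorem sum_increasingOn_mul_star (m : ℕ) :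
    (∑ ρ ∈ increasingOn n m, rightTranslation ρ) *
        star (∑ ρ ∈ increasingOn n m, rightTranslation ρ) =
      ∑ g : Perm (Fin n),
        ((increasingOn n m).filter fun β => g * β ∈ increasingOn n m).card • rightTranslation g := by
  simp only [star_sum, star_rightTranslation, Finset.sum_mul_sum, ← map_mul]
  rw [Finset.sum_comm, eq_comm]
  simp only [← Finset.sum_const]
  rw [Finset.sum_comm' (t' := increasingOn n m)
    (s' := fun β => Finset.univ.filter fun g => g * β ∈ increasingOn n m) (by simp [and_comm])]
  refine Finset.sum_congr rfl fun β _ => ?_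
  refine Finset.sum_nbij' (· * β) (· * β⁻¹) ?_ ?_ ?_ ?_ ?_ <;> simp

theorem card_filter_inv (m : ℕ) (g : Perm (Fin n)) :
    ((increasingOn n m).filter fun β => g⁻¹ * β ∈ increasingOn n m).card =
      ((increasingOn n m).filter fun β => g * β ∈ increasingOn n m).card := by
  refine Finset.card_nbij' (g⁻¹ * ·) (g * ·) ?_ ?_ ?_ ?_
  · intro β hβ; simpa [and_comm] using hβ
  · intro β hβ; simpa [and_comm] using hβ
  · intro β _; simp
  · intro β _; simp

/-- The image of the first `m` positions. -/
def initialImage (m : ℕ) (β : Perm (Fin n)) : Finset (Fin n) :=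
  Finset.univ.filter fun x => (β⁻¹ x).val < m

theorem card_initialImage {m : ℕ} (hm : m ≤ n) (β : Perm (Fin n)) :
    (initialImage m β).card = m := by
  have : initialImage m β = (Finset.univ.filter fun x : Fin n => x.val < m).map β.toEmbedding := by
    ext x
    simp only [initialImage, Finset.mem_filter_univ, Finset.mem_map_equiv]
    rfl
  rw [this, Finset.card_map, Fin.card_filter_val_lt, min_eq_right hm]

/-- The first m entries must list t in increasing order; the other n - m are arbitrary. The fiber is
thus β₀ times the permutations of the positions from m on. -/
theorem card_increasingOn_fiber {m : ℕ} (hm : m ≤ n) {t : Finset (Fin n)} (ht : t.card = m) :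
    ((increasingOn n m).filter fun β => initialImage m β = t).card = (n - m).factorial := by
  obtain ⟨β₀, hβ₀⟩ : ∃ β₀ : Perm (Fin n), ∀ x : Fin n, ∀ hx : x.val < m,
      β₀ x = t.orderEmbOfFin ht ⟨x.val, hx⟩ := by
    let e : {x : Fin n // x.val < m} ≃ Fin m :=
      { toFun := fun x => ⟨x.1.val, x.2⟩
        invFun := fun x => ⟨⟨x.val, by omega⟩, x.2⟩
        left_inv := fun _ => rfl
        right_inv := fun _ => rfl }
    exact ⟨(e.trans (t.orderIsoOfFin ht).toEquiv).extendSubtype, fun x hx =>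
      Equiv.extendSubtype_apply_of_mem _ x hx⟩
  have himg : initialImage m β₀ = t := by
    refine Finset.eq_of_subset_of_card_le ?_ (by rw [card_initialImage hm, ht])
    intro x hx
    have hx' : (β₀⁻¹ x).val < m := by simpa [initialImage] using hx
    have hmem := Finset.orderEmbOfFin_mem t ht ⟨_, hx'⟩
    rw [← hβ₀ _ hx'] at hmem
    simpa using hmem
  have key : ((increasingOn n m).filter fun β => initialImage m β = t) =
      (Finset.univ : Finset (Perm {x : Fin n // ¬ x.val < m})).image
        fun π => β₀ * Perm.ofSubtype π := by
    ext β
    simp only [Finset.mem_filter, Finset.mem_image, Finset.mem_univ, true_and]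
    constructor
    · rintro ⟨hinc, himg'⟩
      have hu := Finset.orderEmbOfFin_unique ht (f := fun i : Fin m => β ⟨i.val, by omega⟩)
        (fun i => (Finset.ext_iff.1 himg' _).1 (by simp [initialImage]))
        (fun i j hij => (Finset.mem_filter.1 hinc).2 _ _ hij j.2)
      have hfix : ∀ x : Fin n, x.val < m → (β₀⁻¹ * β) x = x := fun x hx => by
        rw [Perm.mul_apply, Perm.inv_eq_iff_eq, hβ₀ x hx, ← hu]
      have hmem : ∀ x : Fin n, ¬ ((β₀⁻¹ * β) x).val < m ↔ ¬ x.val < m := fun x => by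
        refine not_congr ⟨fun hx => ?_, fun hx => by rwa [hfix x hx]⟩
        have := hfix _ hx
        rwa [(β₀⁻¹ * β).injective this] at hx
      refine ⟨(β₀⁻¹ * β).subtypePerm hmem, ?_⟩
      ext1 x
      rw [Perm.mul_apply]
      by_cases hx : x.val < m
      · rw [Perm.ofSubtype_apply_of_not_mem (p := fun x : Fin n => ¬ x.val < m) _ (not_not.2 hx),
          hβ₀ x hx, ← hu]
      · rw [Perm.ofSubtype_apply_of_mem (p := fun x : Fin n => ¬ x.val < m) _ hx]
        simp
    · rintro ⟨π, rfl⟩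
      have hfix : ∀ x : Fin n, x.val < m → Perm.ofSubtype π x = x := fun x hx =>
        Perm.ofSubtype_apply_of_not_mem π (not_not.2 hx)
      constructor
      · refine Finset.mem_filter.2 ⟨Finset.mem_univ _, fun i j hij hj => ?_⟩
        have hi : i.val < m := by have := Fin.lt_def.1 hij; omega
        rw [Perm.mul_apply, Perm.mul_apply, hfix i hi, hfix j hj, hβ₀ i hi, hβ₀ j hj]
        exact (t.orderEmbOfFin ht).strictMono hij
      · refine (Finset.eq_of_subset_of_card_le ?_ (by simp [card_initialImage hm])).trans himg
        intro x hx
        simp only [initialImage, Finset.mem_filter_univ, mul_inv_rev, Perm.mul_apply] at hx ⊢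
        have := hfix _ hx
        rw [Perm.inv_def, Equiv.apply_symm_apply] at this
        rwa [this]
  rw [key, Finset.card_image_of_injective _ fun π π' hπ =>
    Perm.ofSubtype_injective (mul_left_cancel hπ), Finset.card_univ, Fintype.card_perm,
    Fintype.card_subtype_compl, Fintype.card_fin, Fintype.card_subtype, Fin.card_filter_val_lt,
    min_eq_right hm]

/-- For β increasing on the first m positions, g β is too exactly when g is increasing on their
image under β. Each image set arises from (n - m)! such β. -/
theorem card_filter_mul_mem {m : ℕ} (hm : m ≤ n) (g : Perm (Fin n)) :
    ((increasingOn n m).filter fun β => g * β ∈ increasingOn n m).card =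
      (n - m).factorial * noninv m g := by
  have hiff : ∀ β ∈ increasingOn n m, (g * β ∈ increasingOn n m ↔
      ∀ i ∈ initialImage m β, ∀ j ∈ initialImage m β, i < j → g i < g j) := by
    intro β hβ
    have hβ := (Finset.mem_filter.1 hβ).2
    have hmono : ∀ i j : Fin n, i.val < m → j.val < m → (i < j ↔ β i < β j) := fun i j hi hj =>
      ⟨fun hij => hβ i j hij hj, fun hij => by
        by_contra hji
        rcases (not_lt.1 hji).eq_or_lt with rfl | hlt
        · exact lt_irrefl _ hij
        · exact lt_asymm hij (hβ j i hlt hi)⟩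
    simp only [increasingOn, Finset.mem_filter_univ, initialImage, Perm.mul_apply]
    constructor
    · intro hinc i hi j hj hij
      have := hinc (β⁻¹ i) (β⁻¹ j) ((hmono _ _ hi hj).2 (by simpa using hij)) hj
      simpa using this
    · intro hinc i j hij hj
      exact hinc _ (by have := Fin.lt_def.1 hij; simp; omega) _ (by simpa) (hβ i j hij hj)
  rw [Finset.card_eq_sum_card_fiberwise (f := initialImage m)
    (t := (Finset.univ.powersetCard m).filter
      fun s => ∀ i ∈ s, ∀ j ∈ s, i < j → g i < g j), noninv, mul_comm, ← smul_eq_mul,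
    ← Finset.sum_const]
  · refine Finset.sum_congr rfl fun t ht => ?_
    rw [Finset.mem_filter, Finset.mem_powersetCard_univ] at ht
    rw [← card_increasingOn_fiber hm ht.1, Finset.filter_filter]
    congr 1
    refine Finset.filter_congr fun β hβ => ⟨fun h => h.2, fun h => ⟨?_, h⟩⟩
    rw [hiff β hβ, h]
    exact ht.2
  · intro β hβ
    rw [Finset.mem_coe, Finset.mem_filter] at hβ ⊢
    exact ⟨Finset.mem_powersetCard_univ.2 (card_initialImage hm β), (hiff β hβ.1).1 hβ.2⟩

theorem noninv_inv {m : ℕ} (hm : m ≤ n) (g : Perm (Fin n)) : noninv m g⁻¹ = noninv m g := by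
  have := card_filter_inv m g
  rw [card_filter_mul_mem hm, card_filter_mul_mem hm] at this
  exact Nat.eq_of_mul_eq_mul_left (Nat.factorial_pos _) this

theorem randomToRandom_eq_sum_noninv {k : ℕ} (hk : k ≤ n) :
    randomToRandom (fun i => rightTranslation (adjacentSwap n i)) n k =
      ∑ g : Perm (Fin n), (k.factorial * noninv (n - k) g) • rightTranslation g := by
  -- The parameter 0 makes the middle factor R_{n-k,0} = 1, leaving X X*.
  have := randomToRandom_eq_mul_star (n := n) (m := n - k) (j := k) (by omega) 0
  rw [zero_add, randomToRandom_zero_right, mul_one, sum_increasingOn_mul_star] at this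
  rw [this]
  refine Finset.sum_congr rfl fun g _ => ?_
  rw [card_filter_mul_mem (by omega), Nat.sub_sub_self hk]

theorem coeff_nu_apply {k : ℕ} (hk : k ≤ n) (v : MonoidAlgebra ℂ (Perm (Fin n)))
    (τ : Perm (Fin n)) :
    (nu n k v).coeff τ = ∑ g : Perm (Fin n), noninv (n - k) g * v.coeff (τ * g) := by
  have h1 : (nu n k v).coeff τ = ∑ σ, v.coeff σ * noninv (n - k) (σ⁻¹ * τ) := by
    rw [nu, Module.Basis.constr_apply_fintype]
    simp [nuCoeff, hk, Module.Basis.equivFun_apply, MonoidAlgebra.basis, Finsupp.single_apply]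
  rw [h1]
  -- Substituting σ = τ g turns σ⁻¹ τ into g⁻¹, hence the need for `noninv_inv`.
  refine Fintype.sum_equiv (Equiv.mulLeft τ⁻¹) _ _ fun σ => ?_
  rw [Equiv.coe_mulLeft, mul_inv_cancel_left, mul_comm, ← noninv_inv (by omega), mul_inv_rev,
    inv_inv]

theorem nu_eq_zero {k : ℕ} (hk : n < k) : nu n k = 0 := by
  refine (MonoidAlgebra.basis (Perm (Fin n)) ℂ).ext fun σ => ?_
  rw [nu, Module.Basis.constr_basis]
  simp [nuCoeff, hk.not_ge]

end Regular

theorem mainTheorem2 (n k : ℕ) (z : ℂ) (hz : (nu n k).HasEigenvalue z) :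
    ∃ m : ℕ, z = (m : ℂ) := by
  obtain ⟨v, hv⟩ := hz.exists_hasEigenvector
  rcases le_or_gt k n with hk | hk
  · refine (isCoxeterFamily_adjacentSwap n).eigenvalue_randomToRandom (n := n) (by omega) k
      (Module.End.hasEigenvalue_of_hasEigenvector (x := WithLp.toLp 2 v.coeff) ⟨?_, ?_⟩)
    · rw [Module.End.mem_eigenspace_iff, randomToRandom_eq_sum_noninv hk]
      ext τ
      have h1 := congrArg (fun w => w.coeff τ) hv.apply_eq_smul
      simp only [coeff_nu_apply hk, MonoidAlgebra.coeff_smul, Finsupp.smul_apply] at h1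
      simp only [LinearMap.sum_apply, LinearMap.smul_apply, WithLp.ofLp_sum, Finset.sum_apply,
        PiLp.smul_apply, rightTranslation_apply]
      simp only [nsmul_eq_mul, Nat.cast_mul, mul_assoc,
        ← Finset.mul_sum, h1, smul_eq_mul]
    · intro h0
      refine hv.2 (MonoidAlgebra.ext (Finsupp.ext fun τ => ?_))
      exact congrArg (fun f : EuclideanSpace ℂ (Perm (Fin n)) => f τ) h0
  · have h1 := hv.apply_eq_smul
    rw [nu_eq_zero hk, LinearMap.zero_apply] at h1
    exact ⟨0, by simpa using (smul_eq_zero.1 h1.symm).resolve_right hv.2⟩
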